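/- Let $X$ be a Hausdorff topological manifold without boundary (every point has an open neighbourhood homeomorphic to an open subset of some $\mathbb{R}^n$; components may have different dimensions, and compactness is not assumed), let a group $G$ act on $X$ by homeomorphisms, and let $f\colon X\to X$ be a continuous map with $f(gx)=gf(x)$ for all $g\in G$, $x\in X$. Two fixed points $y,z$ of $f$ are in the same fixed point class if there is a path $\alpha$ from $y$ to $z$ that is homotopic to $f\circ\alpha$ relative to the endpoints; $[y]$ denotes the class of $y$. For an open set $D\subseteq\mathbb{R}^n$ and a continuous map $\varphi\colon D\to\mathbb{R}^n$ with compact fixed point set $K$, the fixed point index $i(\varphi,D)\in\mathbb{Z}$ is defined by $(\mathrm{id}-\varphi)_*(s_K)=i(\varphi,D)\,s_0$, where $(\mathrm{id}-\varphi)_*\colon H_n(D,D-K)\to H_n(\mathbb{R}^n,\mathbb{R}^n-\{0\})$, and $s_K$, $s_0$ are the classes corresponding to one fundamental class of $S^n=\mathbb{R}^n\cup\{\infty\}$ under $\tilde H_n(S^n)\to H_n(S^n,S^n-K)\cong H_n(D,D-K)$ and $\tilde H_n(S^n)\to H_n(S^n,S^n-\{0\})\cong H_n(\mathbb{R}^n,\mathbb{R}^n-\{0\})$.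 For a compact fixed point class $F$ of $f$, choose an open set $V\subseteq X$ containing $F$, an open set $O\subseteq\mathbb{R}^n$ and continuous maps $s\colon V\to O$, $r\colon O\to V$ with $r\circ s=\mathrm{id}_V$ (for example a chart and its inverse, if $F$ lies in the domain of a chart), and an open set $W\subseteq V$ with $f(W)\subseteq V$ whose fixed points are exactly the points of $F$. The fixed point index of $f$ at $F$ is $i(f,F)=i(s\circ f\circ r,\,r^{-1}(W))$; it does not depend on the choices. Let $x\in X$ be a fixed point of $f$ whose class $[x]$ is compact (which is automatic if $X$ is compact). Then, for every $g\in G$, the point $gx$ is a fixed point of $f$, an integer $k$ is the fixed point index of $f$ at $[x]$ if and only if it is the fixed point index of $f$ at $[gx]$, and hence $$i(f,[gx])=i(f,[x]).$$ -/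

import Mathlib

open CategoryTheory

noncomputable section

namespace FixedPointIndex

/-! ### Relative singular homology with integer coefficients -/

/-- The singular chain complex functor with coefficients in `ℤ`. -/
abbrev singularChains : TopCat.{0} ⥤ ChainComplex (ModuleCat.{0} ℤ) ℕ :=
  (AlgebraicTopology.singularChainComplexFunctor (ModuleCat.{0} ℤ)).obj (ModuleCat.of ℤ ℤ)

/-- The relative singular chain complex `C(X, A) = C(X) / C(A)` of a topological pair. -/
def relativeChains (P : TopPair.{0}) : ChainComplex (ModuleCat.{0} ℤ) ℕ :=
  Limits.cokernel (singularChains.map P.map)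

/-- The map of relative singular chain complexes induced by a map of pairs. -/
def relativeChainsMap {P Q : TopPair.{0}} (f : P ⟶ Q) : relativeChains P ⟶ relativeChains Q :=
  Limits.cokernel.map _ _ (singularChains.map (TopPair.Hom.snd f))
    (singularChains.map (TopPair.Hom.fst f))
    (by rw [← Functor.map_comp, ← Functor.map_comp, TopPair.Hom.w])

/-- The map of pairs `(X, A) ⟶ (Y, B)` given by a continuous map `f` with `f(A) ⊆ B`. -/
def pairMap {X Y : Type} [TopologicalSpace X] [TopologicalSpace Y] {A : Set X} {B : Set Y}
    (f : C(X, Y)) (h : Set.MapsTo f A B) :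
    TopPair.ofSubset (X := TopCat.of X) A ⟶ TopPair.ofSubset (X := TopCat.of Y) B :=
  TopPair.ofHom (TopCat.ofHom f)
    (TopCat.ofHom ⟨h.restrict f A B, f.continuous.restrict h⟩) (by ext x; rfl)

/-- The relative singular homology group `H_n(X, A; ℤ)` for `A ⊆ X`. -/
abbrev relHomology (n : ℕ) {X : Type} [TopologicalSpace X] (A : Set X) : ModuleCat.{0} ℤ :=
  (relativeChains (TopPair.ofSubset (X := TopCat.of X) A)).homology n

/-- The induced map `f_* : H_n(X, A; ℤ) → H_n(Y, B; ℤ)` of a continuous `f` with `f(A) ⊆ B`. -/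
def relHomologyMap (n : ℕ) {X Y : Type} [TopologicalSpace X] [TopologicalSpace Y]
    {A : Set X} {B : Set Y} (f : C(X, Y)) (h : Set.MapsTo f A B) :
    relHomology n A →ₗ[ℤ] relHomology n B :=
  (HomologicalComplex.homologyMap (relativeChainsMap (pairMap f h)) n).hom

/-! ### The fixed point index in Euclidean space -/

/-- `ℝ^n`. -/
abbrev Euc (n : ℕ) : Type := EuclideanSpace ℝ (Fin n)

/-- The inclusion `ℝ^n → S^n = ℝ^n ∪ {∞}`. -/
def toSphere (n : ℕ) : C(Euc n, OnePoint (Euc n)) :=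
  ⟨fun x => (x : OnePoint (Euc n)), OnePoint.continuous_coe⟩

/-- The inclusion `D → S^n = ℝ^n ∪ {∞}` of a subset `D ⊆ ℝ^n`. -/
def inclSphere {n : ℕ} (D : Set (Euc n)) : C(D, OnePoint (Euc n)) :=
  (toSphere n).comp ⟨Subtype.val, continuous_subtype_val⟩

/-- The map `id - φ : D → ℝ^n`. -/
def idSub {n : ℕ} {D : Set (Euc n)} {φ : Euc n → Euc n} (hφ : ContinuousOn φ D) :
    C(D, Euc n) :=
  ⟨fun y => (y : Euc n) - φ y,
    continuous_subtype_val.sub (continuousOn_iff_continuous_domRestrict.mp hφ)⟩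

/-- The fixed point set in `D` of a map `φ : D → ℝ^n` (given as a function on `ℝ^n`). -/
def fixSet {n : ℕ} (D : Set (Euc n)) (φ : Euc n → Euc n) : Set (Euc n) :=
  {y | y ∈ D ∧ φ y = y}

/-- The complement `S^n - A` in the sphere of a subset `A ⊆ ℝ^n`. -/
def sphereMinus {n : ℕ} (A : Set (Euc n)) : Set (OnePoint (Euc n)) :=
  (toSphere n '' A)ᶜ

/-- The complement `D - Fix(φ)` as a subset of `D`. -/
def domMinusFix {n : ℕ} (D : Set (Euc n)) (φ : Euc n → Euc n) : Set D :=
  {y | φ y ≠ y}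

theorem mapsTo_id_sphereMinus {n : ℕ} (A : Set (Euc n)) :
    Set.MapsTo (ContinuousMap.id (OnePoint (Euc n))) {OnePoint.infty} (sphereMinus A) := by
  rintro _ rfl ⟨a, -, ha⟩
  exact OnePoint.coe_ne_infty a ha

theorem mapsTo_inclSphere {n : ℕ} (D : Set (Euc n)) (φ : Euc n → Euc n) :
    Set.MapsTo (inclSphere D) (domMinusFix D φ) (sphereMinus (fixSet D φ)) := by
  rintro y hy ⟨a, ha, hay⟩
  have h : a = (y : Euc n) := OnePoint.coe_injective hay
  subst h
  exact hy ha.2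

theorem mapsTo_toSphere (n : ℕ) :
    Set.MapsTo (toSphere n) ({0}ᶜ : Set (Euc n)) (sphereMinus {0}) := by
  rintro y hy ⟨a, ha, hay⟩
  have h : a = y := OnePoint.coe_injective hay
  exact hy (h ▸ ha)

theorem mapsTo_idSub {n : ℕ} {D : Set (Euc n)} {φ : Euc n → Euc n} (hφ : ContinuousOn φ D) :
    Set.MapsTo (idSub hφ) (domMinusFix D φ) ({0}ᶜ : Set (Euc n)) := by
  intro y hy h
  exact hy (sub_eq_zero.mp h).symm

/-- `k` is the fixed point index `i(φ, D)` of a continuous map `φ : D → ℝ^n` on an open set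
`D ⊆ ℝ^n` with compact fixed point set `F`: if `s` is a fundamental class of `S^n`, `sF` the
element of `H_n(D, D - F)` corresponding to the image of `s` in `H_n(S^n, S^n - F)` under the
excision isomorphism, and `s0` the element of `H_n(ℝ^n, ℝ^n - 0)` corresponding in the same way to
`s`, then `(id - φ)_* sF = k • s0`.  The fundamental class is taken in `H_n(S^n, ∞)`, i.e. in
reduced homology, so that the case `n = 0` is included. -/
def IsEuclideanIndex {n : ℕ} (D : Set (Euc n)) (φ : Euc n → Euc n) (k : ℤ) : Prop :=
  IsOpen D ∧ IsCompact (fixSet D φ) ∧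
  ∃ (hφ : ContinuousOn φ D)
    (s : relHomology n ({OnePoint.infty} : Set (OnePoint (Euc n))))
    (sF : relHomology n (domMinusFix D φ))
    (s0 : relHomology n ({0}ᶜ : Set (Euc n))),
    Submodule.span ℤ {s} = ⊤ ∧
    relHomologyMap n (inclSphere D) (mapsTo_inclSphere D φ) sF =
      relHomologyMap n (ContinuousMap.id _) (mapsTo_id_sphereMinus (fixSet D φ)) s ∧
    relHomologyMap n (toSphere n) (mapsTo_toSphere n) s0 =
      relHomologyMap n (ContinuousMap.id _) (mapsTo_id_sphereMinus {0}) s ∧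
    relHomologyMap n (idSub hφ) (mapsTo_idSub hφ) sF = k • s0

/-! ### Fixed point classes and their index -/

/-- Every point of `X` has an open neighbourhood homeomorphic to an open subset of some `ℝ^n`.
The dimension may depend on the connected component. -/
def IsLocallyEuclidean (X : Type*) [TopologicalSpace X] : Prop :=
  ∀ x : X, ∃ (n : ℕ) (e : OpenPartialHomeomorph X (Euc n)), x ∈ e.source

/-- Two fixed points `x`, `y` of `f` are equivalent if there is a path `α` from `x` to `y` that is
homotopic to `f ∘ α` relative to the endpoints. -/
def FixEquiv {X : Type*} [TopologicalSpace X] (f : C(X, X)) (x y : X) : Prop :=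
  ∃ (hx : f x = x) (hy : f y = y) (α : Path x y),
    α.Homotopic ((α.map f.continuous).cast hx.symm hy.symm)

/-- The fixed point class `[x]` of a fixed point `x` of `f`. -/
def fixClass {X : Type*} [TopologicalSpace X] (f : C(X, X)) (x : X) : Set X :=
  {y | FixEquiv f x y}

/-- `k` is the fixed point index of `f` at the set `F` of fixed points, computed in local Euclidean
coordinates.  Here `V` is an open subset of `X` which is presented, by `s : V → O` and `r : O → V`
with `r ∘ s = id`, as a retract of an open set `O ⊆ ℝ^n`, and `W ⊆ V` is open with `f(W) ⊆ V` and
such that the fixed points of `f` in `W` are exactly the elements of `F`.  Then `k` is the index of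
`s ∘ f ∘ r` on the open set `r⁻¹(W) ⊆ O ⊆ ℝ^n`.

If `F` lies in the domain `V` of a chart `ψ`, one may take `O = ψ(V)`, `s = ψ`, `r = ψ⁻¹`, and `k`
is the index of the coordinate expression `ψ ∘ f ∘ ψ⁻¹` on `ψ(W)`.  Retracts are needed because a
fixed point class need not lie in the domain of one chart. -/
def IsIndexOn {X : Type*} [TopologicalSpace X] (f : C(X, X)) (F : Set X) (k : ℤ) : Prop :=
  ∃ (n : ℕ) (V W : Set X) (O : Set (Euc n)) (s : X → Euc n) (r : Euc n → X),
    IsOpen V ∧ IsOpen O ∧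
    ContinuousOn s V ∧ Set.MapsTo s V O ∧
    ContinuousOn r O ∧ Set.MapsTo r O V ∧
    Set.LeftInvOn r s V ∧
    IsOpen W ∧ W ⊆ V ∧ Set.MapsTo f W V ∧
    {y | y ∈ W ∧ f y = y} = F ∧
    IsEuclideanIndex (O ∩ r ⁻¹' W) (s ∘ f ∘ r) k

open Classical in
/-- The fixed point index `i(f, F)` of a compact, relatively open set `F` of fixed points of `f`;
the unique integer `k` with `IsIndexOn f F k`.  For such `F` on a Hausdorff manifold it exists and is
unique.  (By convention the value is `0` where there is no unique such integer.) -/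
def fixIndex {X : Type*} [TopologicalSpace X] (f : C(X, X)) (F : Set X) : ℤ :=
  if h : ∃! k, IsIndexOn f F k then h.choose else 0

end FixedPointIndex

end

open FixedPointIndex

open FixedPointIndex

open scoped Pointwise

namespace FixedPointIndex

variable {G X : Type*} [Group G] [TopologicalSpace X] [MulAction G X] [ContinuousConstSMul G X]
  {f : C(X, X)}

/-! Equivariance says that each $g$ is a homeomorphism of $X$ conjugating $f$ to itself, so $g$
transports every ingredient of the index. Translating paths and homotopies gives $[gx] = g[x]$
(`fixClass_smul`). Translating the retract data for $F$ gives data for $gF$ with literally the same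
Euclidean map and domain (`IsIndexOn.smul`), so no property of homology is needed. -/

/-- An equivariant map sends equivalent fixed points to equivalent fixed points along translates. -/
theorem FixEquiv.smul (hf : ∀ (g : G) (x : X), f (g • x) = g • f x) {x y : X}
    (h : FixEquiv f x y) (g : G) : FixEquiv f (g • x) (g • y) := by
  obtain ⟨hx, hy, α, ⟨H⟩⟩ := h
  refine ⟨by rw [hf, hx], by rw [hf, hy], α.map (continuous_const_smul g), ⟨?_⟩⟩
  -- The translated homotopy ends at $g \circ f \circ \alpha$, which equivariance identifies with $f
  -- \circ (g\alpha)$.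
  refine (H.map ⟨fun z => g • z, continuous_const_smul g⟩).cast rfl ?_
  ext t
  simpa using (hf g (α t)).symm

/-- The fixed point class of a translated fixed point is the translated fixed point class. -/
theorem fixClass_smul (hf : ∀ (g : G) (x : X), f (g • x) = g • f x) (x : X) (g : G) :
    fixClass f (g • x) = g • fixClass f x := by
  ext y
  rw [Set.mem_smul_set_iff_inv_smul_mem]
  exact ⟨fun h => by simpa [fixClass] using FixEquiv.smul hf h g⁻¹,
    fun h => by simpa [fixClass] using FixEquiv.smul hf h g⟩

/-- Local Euclidean coordinates for the index at `F`, translated by `g`, are local Euclidean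
coordinates for the index at `g • F`, with the same coordinate expression of `f`. -/
theorem IsIndexOn.smul (hf : ∀ (g : G) (x : X), f (g • x) = g • f x) {F : Set X} {k : ℤ}
    (h : IsIndexOn f F k) (g : G) : IsIndexOn f (g • F) k := by
  obtain ⟨n, V, W, O, s, r, hV, hO, hs, hsm, hr, hrm, hrs, hW, hWV, hfW, hfix, hk⟩ := h
  have hinv : Set.MapsTo (fun z => g⁻¹ • z) (g • V) V := fun z hz =>
    Set.mem_smul_set_iff_inv_smul_mem.mp hz
  -- Only the side in $X$ moves: $s' = s \circ g^{-1}$ and $r' = g \circ r$, with $O$ unchanged.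
  refine ⟨n, g • V, g • W, O, fun z => s (g⁻¹ • z), fun z => g • r z, hV.smul g, hO,
    hs.comp (continuous_const_smul g⁻¹).continuousOn hinv, fun z hz => hsm (hinv hz),
    hr.const_smul g, fun z hz => Set.smul_mem_smul_set (hrm hz), fun z hz => ?_, hW.smul g,
    Set.smul_set_mono hWV, ?_, ?_, ?_⟩
  · simp only [hrs (hinv hz), smul_inv_smul]
  · rintro _ ⟨w, hw, rfl⟩
    simp only [hf]
    exact Set.smul_mem_smul_set (hfW hw)
  -- Since $f(g^{-1}y) = g^{-1}f(y)$, cancelling $g^{-1}$ shows that $g^{-1}y$ is fixed exactly when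
  -- $y$ is.
  · ext y
    rw [Set.mem_smul_set_iff_inv_smul_mem, ← hfix, Set.mem_ofPred_eq, Set.mem_ofPred_eq,
      Set.mem_smul_set_iff_inv_smul_mem, hf, smul_left_cancel_iff]
  -- The translations cancel: $r'^{-1}(gW) = r^{-1}(W)$ and $s g^{-1} f g r = s f r$, so the old
  -- Euclidean index applies verbatim.
  · have hdom : (fun z => g • r z) ⁻¹' (g • W) = r ⁻¹' W := by
      ext z
      exact Set.smul_mem_smul_set_iff
    have hmap : (fun z => s (g⁻¹ • z)) ∘ f ∘ (fun z => g • r z) = s ∘ f ∘ r := by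
      ext1 z
      simp only [Function.comp_apply, hf, inv_smul_smul]
    rwa [hdom, hmap]

/-- The index of an equivariant map is invariant under translation of the fixed point set. -/
theorem isIndexOn_smul_iff (hf : ∀ (g : G) (x : X), f (g • x) = g • f x) {F : Set X} {k : ℤ}
    (g : G) : IsIndexOn f (g • F) k ↔ IsIndexOn f F k :=
  ⟨fun h => by simpa using h.smul hf g⁻¹, fun h => h.smul hf g⟩

end FixedPointIndex

theorem proposition4p7 {G X : Type*} [Group G] [TopologicalSpace X] [T2Space X]
    (hX : IsLocallyEuclidean X) [MulAction G X] [ContinuousConstSMul G X]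
    (f : C(X, X)) (hf : ∀ (g : G) (x : X), f (g • x) = g • f x)
    (x : X) (hx : f x = x) (hF : IsCompact (fixClass f x)) (g : G) :
    f (g • x) = g • x ∧
      (∀ k : ℤ, IsIndexOn f (fixClass f x) k ↔ IsIndexOn f (fixClass f (g • x)) k) ∧
      fixIndex f (fixClass f x) = fixIndex f (fixClass f (g • x)) := by
  have hiff : ∀ k : ℤ,
      IsIndexOn f (fixClass f x) k ↔ IsIndexOn f (fixClass f (g • x)) k := fun k => by
    rw [fixClass_smul hf, isIndexOn_smul_iff hf]
  refine ⟨by rw [hf, hx], hiff, ?_⟩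
  -- `fixIndex` depends on the class only through this predicate, so equal predicates suffice;
  -- existence and uniqueness of the index play no role, and the default value $0$ is covered too.
  have heq : IsIndexOn f (fixClass f x) = IsIndexOn f (fixClass f (g • x)) :=
    funext fun k => propext (hiff k)
  unfold fixIndex
  rw [heq]
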